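/- A semigroup is hopfian if every surjective endomorphism of it is an automorphism, and finitely presented if it has a semigroup presentation with finitely many generators and finitely many defining relations. For a subsemigroup $T$ of a semigroup $S$ and $x,y\in S$, put $xT^1=\{x\}\cup xT$ and $T^1x=\{x\}\cup Tx$, and write $x\,\mathcal{H}^T\,y$ if $xT^1=yT^1$ and $T^1x=T^1y$; the Green index of $T$ in $S$ is one more than the number of $\mathcal{H}^T$-classes contained in $S\setminus T$. Let $F$ be the free group with basis $\{x,y,z\}$, let $G$ be the group with presentation $\langle a,b,c \mid a^{-1}ba=b^2,\ bc=cb\rangle$ (Neumann's group), and let $\phi:F\to G$ be the homomorphism with $x\mapsto a$, $y\mapsto b$, $z\mapsto c$. Let $S$ be the Clifford semigroup formed from $F>G$ and $\phi$, that is, the disjoint union $S=F\sqcup G$, where products within $F$ and within $G$ are those of these groups, and $f\cdot g=(f\phi)g$, $g\cdot f=g(f\phi)$ for $f\in F$, $g\in G$. Then: 1. $G$ is not hopfian, and $\phi$ is surjective. 2. $S$ is a finitely presented semigroup and is not hopfian. 3. The natural map $F\to S$ is an injective homomorphism, and its image, the subsemigroup $F$ of $S$, is hopfian, is finitely presented as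 a semigroup, and has Green index $2$ in $S$ (in particular, finite Green index). Consequently, hopficity is not inherited by finite Green index extensions, even for finitely presented semigroups: it is not true that whenever $S$ is a finitely presented semigroup and $T$ is a finitely presented hopfian subsemigroup of finite Green index in $S$, the semigroup $S$ is hopfian. -/

import Mathlib

/-- A semigroup is hopfian if every surjective endomorphism of it is an automorphism.
(On a group, every semigroup endomorphism is a group endomorphism, so for groups this is the usual
notion of a hopfian group.) -/
def IsHopfian (S : Type*) [Semigroup S] : Prop :=
  ∀ f : S →ₙ* S, Function.Surjective f → Function.Bijective f

/-- A semigroup is finitely presented (as a semigroup) if it is isomorphic to the quotient of a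
free semigroup on finitely many generators by the congruence generated by finitely many pairs. -/
def IsFinitelyPresentedSemigroup (S : Type*) [Semigroup S] : Prop :=
  ∃ (n : ℕ) (R : Set (FreeSemigroup (Fin n) × FreeSemigroup (Fin n))), R.Finite ∧
    Nonempty (S ≃* (conGen fun u v => (u, v) ∈ R).Quotient)

section Green

variable {S : Type*} [Semigroup S]

/-- The set `x T¹ = {x} ∪ x T`. -/
def rightOrbit (T : Subsemigroup S) (x : S) : Set S :=
  insert x {s | ∃ t ∈ T, s = x * t}

/-- The set `T¹ x = {x} ∪ T x`. -/
def leftOrbit (T : Subsemigroup S) (x : S) : Set S :=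
  insert x {s | ∃ t ∈ T, s = t * x}

/-- The `T`-relative Green's relation `R` on `S`. -/
def RelR (T : Subsemigroup S) (x y : S) : Prop := rightOrbit T x = rightOrbit T y

/-- The `T`-relative Green's relation `L` on `S`. -/
def RelL (T : Subsemigroup S) (x y : S) : Prop := leftOrbit T x = leftOrbit T y

/-- The `T`-relative Green's relation `H` on `S`. -/
def RelH (T : Subsemigroup S) (x y : S) : Prop := RelR T x y ∧ RelL T x y

/-- The Green index of `T` in `S`: one more than the number of `T`-relative `H`-classes
in `S - T`. -/
noncomputable def greenIndex (T : Subsemigroup S) : ℕ∞ :=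
  {C : Set S | ∃ x : S, x ∉ T ∧ C = {y | RelH T x y}}.encard + 1

end Green

/-- The underlying set of the Clifford semigroup (strong semilattice of groups) formed from two
groups `F > G` and a homomorphism `φ : F →* G`: the disjoint union of `F` and `G`. -/
inductive CliffordPair {F G : Type*} [Group F] [Group G] (φ : F →* G) : Type _
  | top (f : F) : CliffordPair φ
  | bot (g : G) : CliffordPair φ

namespace CliffordPair

variable {F G : Type*} [Group F] [Group G] (φ : F →* G)

/-- Two elements are multiplied in the group indexed by the meet of their indices, after mapping
both of them into that group. -/
def mul : CliffordPair φ → CliffordPair φ → CliffordPair φ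
  | top f, top f' => top (f * f')
  | top f, bot g => bot (φ f * g)
  | bot g, top f => bot (g * φ f)
  | bot g, bot g' => bot (g * g')

instance : Semigroup (CliffordPair φ) where
  mul := mul φ
  mul_assoc x y z := by
    change mul φ (mul φ x y) z = mul φ x (mul φ y z)
    cases x <;> cases y <;> cases z <;> simp [mul, mul_assoc]

/-- The inclusion of the upper group. -/
def topHom : F →ₙ* CliffordPair φ where
  toFun := top
  map_mul' _ _ := rfl

/-- The upper group as a subsemigroup. -/
def upper : Subsemigroup (CliffordPair φ) := (topHom φ).srange

end CliffordPair

/-- The relators `a⁻¹ba(b²)⁻¹` and `bc(cb)⁻¹`, for the generators `a = 0`, `b = 1`, `c = 2`. -/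
def neumannRels : Set (FreeGroup (Fin 3)) :=
  let a := FreeGroup.of (0 : Fin 3)
  let b := FreeGroup.of (1 : Fin 3)
  let c := FreeGroup.of (2 : Fin 3)
  {a⁻¹ * b * a * (b ^ 2)⁻¹, b * c * (c * b)⁻¹}

/-- Neumann's group `⟨a, b, c | a⁻¹ba = b², bc = cb⟩`. -/
abbrev NeumannGroup : Type := PresentedGroup neumannRels

/-- The homomorphism from the free group on `x = 0`, `y = 1`, `z = 2` to Neumann's group with
`x ↦ a`, `y ↦ b`, `z ↦ c`. -/
def neumannMap : FreeGroup (Fin 3) →* NeumannGroup :=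
  FreeGroup.lift fun i => PresentedGroup.of i

/-- The Clifford semigroup formed from the free group of rank 3, Neumann's group and
`neumannMap`. -/
abbrev NeumannClifford : Type := CliffordPair neumannMap

/-!
Write `a, b, c` for the generators of Neumann's group `G`, and `φ : F → G` for the presentation map.

The relation `a⁻¹ba = b²` makes `a ↦ a, b ↦ b², c ↦ c` an endomorphism `ψ` of `G`
(`neumannEndo`). As `b²` equals `a⁻¹ba`, it lifts through `φ` to the *automorphism*
`x ↦ x, y ↦ x⁻¹yx, z ↦ z` of the free group (`conjEndo`). So `ψ` is surjective, and it extends to a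
surjective endomorphism of the Clifford semigroup `S`, given by `conjEndo` on the upper group and by
`ψ` on the lower one. Neither is injective: `ψ` sends the commutator of `aba⁻¹` and `c` to that of
`b` and `c`, which is trivial, whereas `aba⁻¹` and `c` do not commute in `G`. The latter is seen in
the permutations of `ℚ`: take `a : t ↦ t / 2`, `b : t ↦ t + 1`, and for `c` the map that agrees with
`b` on `ℤ` and is the identity elsewhere (`exists_neumannMap_ne_one`).

Finite presentability is verified through a universal property
(`isFinitelyPresentedSemigroup_of_universal`). As a semigroup, the free group is presented by its
generators, their inverses and an identity, with the evident relations
(`exists_mulHom_of_freeGroupRels`: a family satisfying these relations lies in the monoid `eQe`,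
where it consists of units). For the Clifford semigroup one more generator is added, the identity
`i` of the lower group, with relations saying that `i` is a central idempotent below the identity
and that `i * r = i` for each relator `r` of `G`
(`isFinitelyPresentedSemigroup_cliffordPair`).

The free group is hopfian by Malcev's argument: finitely generated residually finite groups are
hopfian (`isHopfian_of_residuallyFinite`), and free groups are residually finite
(`FreeGroup.residuallyFinite`), because left multiplication by the generators restricts to partial
injections on the set of suffixes of a word, and these extend to permutations of that finite set.

The lower group is a single relative `H`-class since `φ` is surjective, so the Green index is `2`.
-/

/-! ### Finite presentations of semigroups -/

/-- A semigroup is finitely presented if it has the universal property of a finite presentation: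
it is generated by a finite family `f` satisfying the relations in `R`, and every other family
satisfying them is the image of `f` under a homomorphism. -/
theorem isFinitelyPresentedSemigroup_of_universal {S α : Type*} [Semigroup S] [Finite α]
    (R : Set (FreeSemigroup α × FreeSemigroup α)) (hR : R.Finite) (f : α → S)
    (hf : Function.Surjective (FreeSemigroup.lift f))
    (hrel : ∀ r ∈ R, FreeSemigroup.lift f r.1 = FreeSemigroup.lift f r.2)
    (huniv : ∀ {Q : Type} [Semigroup Q] (q : α → Q),
      (∀ r ∈ R, FreeSemigroup.lift q r.1 = FreeSemigroup.lift q r.2) →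
        ∃ g : S →ₙ* Q, ∀ a, g (f a) = q a) :
    IsFinitelyPresentedSemigroup S := by
  obtain ⟨n, ⟨e⟩⟩ := Finite.exists_equiv_fin α
  let m : FreeSemigroup α →ₙ* FreeSemigroup (Fin n) := FreeSemigroup.map e
  let R' := Prod.map m m '' R
  let c := conGen fun u v => (u, v) ∈ R'
  have hq : FreeSemigroup.lift (fun a => Con.mkMulHom c (.of (e a))) = (Con.mkMulHom c).comp m :=
    FreeSemigroup.hom_ext rfl
  obtain ⟨g, hg⟩ := huniv (fun a => Con.mkMulHom c (.of (e a))) fun r hr => by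
    rw [hq]
    exact c.eq.2 (ConGen.Rel.of _ _ ⟨r, hr, rfl⟩)
  let f' : FreeSemigroup (Fin n) →ₙ* S := FreeSemigroup.lift (f ∘ e.symm)
  have hf' : f'.comp m = FreeSemigroup.lift f :=
    FreeSemigroup.hom_ext (funext fun a => by simp [f', m])
  have hle : c ≤ Con.ker f' := Con.conGen_le.2 <| by
    rintro _ _ ⟨r, hr, ⟨⟩⟩
    have := hrel r hr
    rwa [← hf'] at this
  have hgf : ∀ u, g (f' u) = Con.mkMulHom c u := DFunLike.congr_fun
    (FreeSemigroup.hom_ext (f := g.comp f') (funext fun a => by simp [f', hg]))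
  have hsurj : Function.Surjective f' := fun s => by
    obtain ⟨u, rfl⟩ := hf s
    exact ⟨m u, DFunLike.congr_fun hf' u⟩
  refine ⟨n, R', hR.image _, ⟨MulEquiv.ofBijective g ⟨fun s t hst => ?_, fun x => ?_⟩⟩⟩
  · obtain ⟨u, rfl⟩ := hsurj s
    obtain ⟨v, rfl⟩ := hsurj t
    rw [hgf, hgf] at hst
    exact hle (c.eq.1 hst)
  · induction x using Con.induction_on with
    | H u => exact ⟨f' u, hgf u⟩

theorem IsFinitelyPresentedSemigroup.of_mulEquiv {S T : Type*} [Semigroup S] [Semigroup T]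
    (e : S ≃* T) (h : IsFinitelyPresentedSemigroup S) : IsFinitelyPresentedSemigroup T := by
  obtain ⟨n, R, hR, ⟨e'⟩⟩ := h
  exact ⟨n, R, hR, ⟨e.symm.trans e'⟩⟩

/-! ### The free group as a semigroup -/

section FreeGroup

open FreeSemigroup

/-- Relations presenting the free group on `ι` as a semigroup. The generator `none` stands for the
identity, and `some (a, true)`, `some (a, false)` for `a` and its inverse. -/
def freeGroupRels (ι : Type*) :
    Set (FreeSemigroup (Option (ι × Bool)) × FreeSemigroup (Option (ι × Bool))) :=
  {(of none * of none, of none)} ∪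
    Set.range (fun x : ι × Bool => (of none * of (some x), of (some x))) ∪
    Set.range (fun x : ι × Bool => (of (some x) * of none, of (some x))) ∪
    Set.range (fun x : ι × Bool => (of (some x) * of (some (x.1, !x.2)), of none))

/-- The values in the free group of the generators used in `freeGroupRels`. -/
def freeGroupGen {ι : Type*} : Option (ι × Bool) → FreeGroup ι
  | none => 1
  | some x => FreeGroup.mk [x]

theorem finite_freeGroupRels (ι : Type*) [Finite ι] : (freeGroupRels ι).Finite :=
  (((Set.finite_singleton _).union (Set.finite_range _)).union (Set.finite_range _)).union
    (Set.finite_range _)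

theorem forall_freeGroupRels_iff {ι Q : Type*} [Semigroup Q] {q : Option (ι × Bool) → Q} :
    (∀ r ∈ freeGroupRels ι, lift q r.1 = lift q r.2) ↔
      q none * q none = q none ∧ (∀ x, q none * q (some x) = q (some x)) ∧
        (∀ x, q (some x) * q none = q (some x)) ∧
        ∀ x : ι × Bool, q (some x) * q (some (x.1, !x.2)) = q none := by
  simp only [freeGroupRels, Set.mem_union, Set.mem_singleton_iff, Set.mem_range, or_imp,
    forall_and, forall_eq, forall_exists_index, forall_apply_eq_imp_iff, map_mul, lift_of,
    and_assoc]

theorem freeGroupGen_rels (ι : Type*) :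
    ∀ r ∈ freeGroupRels ι, lift freeGroupGen r.1 = lift freeGroupGen r.2 := by
  refine forall_freeGroupRels_iff.2 ⟨one_mul _, fun _ => one_mul _, fun _ => mul_one _, ?_⟩
  rintro ⟨a, _ | _⟩
  · exact inv_mul_cancel (FreeGroup.of a)
  · exact mul_inv_cancel (FreeGroup.of a)

theorem lift_freeGroupGen_surjective (ι : Type*) :
    Function.Surjective (lift (freeGroupGen (ι := ι))) := by
  intro g
  induction g using FreeGroup.induction_on with
  | C1 => exact ⟨of none, rfl⟩
  | of a => exact ⟨of (some (a, true)), rfl⟩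
  | inv_of a => exact ⟨of (some (a, false)), rfl⟩
  | mul g h hg hh =>
    obtain ⟨u, rfl⟩ := hg
    obtain ⟨v, rfl⟩ := hh
    exact ⟨u * v, map_mul _ _ _⟩

/-- The universal property of the semigroup presentation `freeGroupRels`. The element `q none` need
not be an identity of `Q`. -/
theorem exists_mulHom_of_freeGroupRels {ι Q : Type*} [Semigroup Q] (q : Option (ι × Bool) → Q)
    (hq : ∀ r ∈ freeGroupRels ι, lift q r.1 = lift q r.2) :
    ∃ h : FreeGroup ι →ₙ* Q, ∀ a, h (freeGroupGen a) = q a := by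
  obtain ⟨he, hl, hr, hinv⟩ := forall_freeGroupRels_iff.1 hq
  have idem : IsIdempotentElem (q none) := he
  let _ : Monoid (Subsemigroup.corner (q none)) :=
    { one := ⟨q none, (Subsemigroup.mem_corner_iff idem).2 ⟨he, he⟩⟩
      one_mul := fun r => Subtype.ext ((Subsemigroup.mem_corner_iff idem).1 r.2).1
      mul_one := fun r => Subtype.ext ((Subsemigroup.mem_corner_iff idem).1 r.2).2 }
  let p (x : ι × Bool) : Subsemigroup.corner (q none) :=
    ⟨q (some x), (Subsemigroup.mem_corner_iff idem).2 ⟨hl x, hr x⟩⟩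
  let u (a : ι) : (Subsemigroup.corner (q none))ˣ :=
    ⟨p (a, true), p (a, false), Subtype.ext (hinv (a, true)), Subtype.ext (hinv (a, false))⟩
  refine ⟨⟨fun g => ((FreeGroup.lift u g : (Subsemigroup.corner (q none))ˣ) :
    Subsemigroup.corner (q none)), fun g h => by simp⟩, ?_⟩
  rintro (_ | ⟨a, _ | _⟩)
  · change (((FreeGroup.lift u 1 : (Subsemigroup.corner (q none))ˣ) :
      Subsemigroup.corner (q none)) : Q) = q none
    rw [map_one]
    rfl
  · change (((FreeGroup.lift u (FreeGroup.of a)⁻¹ : (Subsemigroup.corner (q none))ˣ) :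
      Subsemigroup.corner (q none)) : Q) = q (some (a, false))
    rw [map_inv, FreeGroup.lift_apply_of]
    rfl
  · change (((FreeGroup.lift u (FreeGroup.of a) : (Subsemigroup.corner (q none))ˣ) :
      Subsemigroup.corner (q none)) : Q) = q (some (a, true))
    rw [FreeGroup.lift_apply_of]

theorem isFinitelyPresentedSemigroup_freeGroup (ι : Type*) [Finite ι] :
    IsFinitelyPresentedSemigroup (FreeGroup ι) :=
  isFinitelyPresentedSemigroup_of_universal (freeGroupRels ι) (finite_freeGroupRels ι) freeGroupGen
    (lift_freeGroupGen_surjective ι) (freeGroupGen_rels ι) exists_mulHom_of_freeGroupRels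

end FreeGroup

/-! ### Clifford semigroups of two groups -/

namespace CliffordPair

section

variable {F G : Type*} [Group F] [Group G] {φ : F →* G}

@[simp] theorem top_mul_top (f f' : F) : (top f * top f' : CliffordPair φ) = top (f * f') := rfl

@[simp] theorem top_mul_bot (f : F) (g : G) : (top f * bot g : CliffordPair φ) = bot (φ f * g) :=
  rfl

@[simp] theorem bot_mul_top (g : G) (f : F) : (bot g * top f : CliffordPair φ) = bot (g * φ f) :=
  rfl

@[simp] theorem bot_mul_bot (g g' : G) : (bot g * bot g' : CliffordPair φ) = bot (g * g') := rfl

theorem topHom_injective : Function.Injective (topHom φ) := fun _ _ h => top.inj h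

theorem top_mem_upper (f : F) : (top f : CliffordPair φ) ∈ upper φ := ⟨f, rfl⟩

theorem bot_notMem_upper (g : G) : (bot g : CliffordPair φ) ∉ upper φ := by
  rintro ⟨f, ⟨⟩⟩

variable (φ) in
/-- The upper group is a copy of `F`. -/
noncomputable def upperEquiv : F ≃* upper φ :=
  MulEquiv.ofBijective (topHom φ).srangeRestrict
    ⟨fun _ _ h => topHom_injective (congrArg Subtype.val h), (topHom φ).srangeRestrict_surjective⟩

/-- Endomorphisms of the two groups that are compatible with `φ` combine to an endomorphism of the
Clifford semigroup. -/
def map (α : F →* F) (ψ : G →* G) (h : ∀ f, ψ (φ f) = φ (α f)) :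
    CliffordPair φ →ₙ* CliffordPair φ where
  toFun
    | top f => top (α f)
    | bot g => bot (ψ g)
  map_mul' x y := by cases x <;> cases y <;> simp [h]

theorem map_surjective {α : F →* F} {ψ : G →* G} (h : ∀ f, ψ (φ f) = φ (α f))
    (hα : Function.Surjective α) (hψ : Function.Surjective ψ) :
    Function.Surjective (map α ψ h) := by
  rintro (f | g)
  · obtain ⟨f, rfl⟩ := hα f
    exact ⟨top f, rfl⟩
  · obtain ⟨g, rfl⟩ := hψ g
    exact ⟨bot g, rfl⟩

theorem rightOrbit_bot (hφ : Function.Surjective φ) (g : G) :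
    rightOrbit (upper φ) (bot g) = Set.range bot := by
  refine Set.Subset.antisymm ?_ ?_
  · rintro _ (rfl | ⟨_, ⟨f, rfl⟩, rfl⟩)
    · exact ⟨g, rfl⟩
    · exact ⟨g * φ f, rfl⟩
  · rintro _ ⟨g', rfl⟩
    obtain ⟨f, hf⟩ := hφ (g⁻¹ * g')
    exact Or.inr ⟨top f, top_mem_upper f, by simp [hf]⟩

theorem leftOrbit_bot (hφ : Function.Surjective φ) (g : G) :
    leftOrbit (upper φ) (bot g) = Set.range bot := by
  refine Set.Subset.antisymm ?_ ?_
  · rintro _ (rfl | ⟨_, ⟨f, rfl⟩, rfl⟩)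
    · exact ⟨g, rfl⟩
    · exact ⟨φ f * g, rfl⟩
  · rintro _ ⟨g', rfl⟩
    obtain ⟨f, hf⟩ := hφ (g' * g⁻¹)
    exact Or.inr ⟨top f, top_mem_upper f, by simp [hf]⟩

/-- The lower group is a single relative `H`-class. -/
theorem setOf_relH_bot (hφ : Function.Surjective φ) (g : G) :
    {y | RelH (upper φ) (bot g) y} = Set.range bot := by
  ext y
  constructor
  · rintro ⟨h, -⟩
    rw [← rightOrbit_bot hφ g, h]
    exact Set.mem_insert _ _
  · rintro ⟨g', rfl⟩
    exact ⟨(rightOrbit_bot hφ g).trans (rightOrbit_bot hφ g').symm,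
      (leftOrbit_bot hφ g).trans (leftOrbit_bot hφ g').symm⟩

theorem greenIndex_upper (hφ : Function.Surjective φ) : greenIndex (upper φ) = 2 := by
  have : {C : Set (CliffordPair φ) | ∃ x, x ∉ upper φ ∧ C = {y | RelH (upper φ) x y}} =
      {Set.range bot} := by
    ext C
    constructor
    · rintro ⟨f | g, hx, rfl⟩
      · exact absurd (top_mem_upper f) hx
      · exact setOf_relH_bot hφ g
    · rintro rfl
      exact ⟨bot 1, bot_notMem_upper 1, (setOf_relH_bot hφ 1).symm⟩
  rw [greenIndex, this, Set.encard_singleton, one_add_one_eq_two]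

end

open FreeSemigroup

/-- If `i` is an idempotent commuting with the values of `h`, and `i * h r = i` for all relators `r`
of `G`, then `i * h f` depends on the image of `f` in `G` only. -/
theorem mul_eq_of_map_eq {F G Q : Type*} [Group F] [Group G] [Semigroup Q] {φ : F →* G}
    {rels : Set F} (hker : φ.ker = Subgroup.normalClosure rels) (h : F →ₙ* Q) (i : Q)
    (hone : i * h 1 = i) (hcomm : ∀ f, i * h f = h f * i) (hrels : ∀ r ∈ rels, i * h r = i)
    {f f' : F} (hff' : φ f = φ f') : i * h f = i * h f' := by
  let K : Subgroup F :=
    { carrier := {f | i * h f = i}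
      one_mem' := hone
      mul_mem' := fun {f f'} hf hf' => by
        simp only [Set.mem_ofPred_eq] at *
        rw [map_mul, ← mul_assoc, hf, hf']
      inv_mem' := fun {f} hf => by
        simp only [Set.mem_ofPred_eq] at *
        calc i * h f⁻¹ = i * h f * h f⁻¹ := by rw [hf]
          _ = i := by rw [mul_assoc, ← map_mul, mul_inv_cancel, hone] }
  have hK : K.Normal := ⟨fun f hf g => by
    change i * h (g * f * g⁻¹) = i
    change i * h f = i at hf
    rw [map_mul, map_mul, ← mul_assoc, ← mul_assoc, hcomm, mul_assoc (h g), hf, ← hcomm, mul_assoc,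
      ← map_mul, mul_inv_cancel, hone]⟩
  have hle : φ.ker ≤ K := hker ▸ Subgroup.normalClosure_le_normal hrels
  have hmem : i * h (f * f'⁻¹) = i := hle (by simp [MonoidHom.mem_ker, hff'])
  calc i * h f = i * h (f * f'⁻¹) * h f' := by rw [mul_assoc, ← map_mul, inv_mul_cancel_right]
    _ = i * h f' := by rw [hmem]

/-- The generators of the Clifford semigroup of `φ : FreeGroup ι →* G`: those of the upper group,
and the identity `none` of the lower one. -/
def gen {ι G : Type*} [Group G] (φ : FreeGroup ι →* G) :
    Option (Option (ι × Bool)) → CliffordPair φ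
  | none => bot 1
  | some a => top (freeGroupGen a)

/-- A word in the semigroup generators of the free group representing the given element. -/
noncomputable def word {ι : Type*} : FreeGroup ι → FreeSemigroup (Option (ι × Bool)) :=
  Function.surjInv (lift_freeGroupGen_surjective ι)

theorem lift_freeGroupGen_word {ι : Type*} (f : FreeGroup ι) : lift freeGroupGen (word f) = f :=
  Function.surjInv_eq (lift_freeGroupGen_surjective ι) f

/-- Relations presenting the Clifford semigroup of `FreeGroup ι →* G`, where `G` is given by the
relators `rels`. -/
noncomputable def cliffordRels {ι : Type*} (rels : Set (FreeGroup ι)) :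
    Set (FreeSemigroup (Option (Option (ι × Bool))) ×
      FreeSemigroup (Option (Option (ι × Bool)))) :=
  Prod.map (FreeSemigroup.map some) (FreeSemigroup.map some) '' freeGroupRels ι ∪
    {(of none * of none, of none)} ∪ {(of none * of (some none), of none)} ∪
    Set.range (fun a => (of none * of (some a), of (some a) * of none)) ∪
    (fun r => (of none * FreeSemigroup.map some (word r), of none)) '' rels

theorem lift_map_some {α Q : Type*} [Semigroup Q] (q : Option α → Q) (u : FreeSemigroup α) :
    lift q (FreeSemigroup.map some u) = lift (fun a => q (some a)) u :=
  DFunLike.congr_fun (FreeSemigroup.hom_ext (f := (lift q).comp (FreeSemigroup.map some))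
    (g := lift fun a => q (some a)) rfl) u

theorem forall_cliffordRels_iff {ι Q : Type*} [Semigroup Q] {rels : Set (FreeGroup ι)}
    {q : Option (Option (ι × Bool)) → Q} :
    (∀ r ∈ cliffordRels rels, lift q r.1 = lift q r.2) ↔
      (∀ r ∈ freeGroupRels ι,
        lift (fun a => q (some a)) r.1 = lift (fun a => q (some a)) r.2) ∧
      q none * q none = q none ∧ q none * q (some none) = q none ∧
      (∀ a, q none * q (some a) = q (some a) * q none) ∧
      ∀ r ∈ rels, q none * lift (fun a => q (some a)) (word r) = q none := by
  simp only [cliffordRels, Set.mem_union, Set.mem_singleton_iff, Set.mem_range, Set.mem_image,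
    or_imp, forall_and, forall_eq, forall_exists_index, and_imp, forall_apply_eq_imp_iff,
    forall_apply_eq_imp_iff₂, map_mul, lift_of, lift_map_some, and_assoc, Prod.map_fst,
    Prod.map_snd]

variable {ι G : Type*} [Group G] {φ : FreeGroup ι →* G}

theorem lift_gen_some (u : FreeSemigroup (Option (ι × Bool))) :
    lift (fun a => gen φ (some a)) u = top (lift freeGroupGen u) :=
  DFunLike.congr_fun (FreeSemigroup.hom_ext (f := lift fun a => gen φ (some a))
    (g := (topHom φ).comp (lift freeGroupGen)) rfl) u

theorem gen_rels {rels : Set (FreeGroup ι)} (hker : φ.ker = Subgroup.normalClosure rels) :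
    ∀ r ∈ cliffordRels rels, lift (gen φ) r.1 = lift (gen φ) r.2 := by
  refine forall_cliffordRels_iff.2 ⟨fun r hr => ?_, ?_, ?_, fun a => ?_, fun r hr => ?_⟩
  · rw [lift_gen_some, lift_gen_some, freeGroupGen_rels ι r hr]
  · simp [gen]
  · simp [gen, freeGroupGen]
  · simp [gen]
  · have : φ r = 1 := MonoidHom.mem_ker.1 (hker ▸ Subgroup.subset_normalClosure hr)
    rw [lift_gen_some, lift_freeGroupGen_word]
    simp [gen, this]

theorem lift_gen_surjective (hφ : Function.Surjective φ) :
    Function.Surjective (lift (gen φ)) := by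
  have htop (f : FreeGroup ι) : lift (gen φ) (FreeSemigroup.map some (word f)) = top f := by
    rw [lift_map_some, lift_gen_some, lift_freeGroupGen_word]
  rintro (f | g)
  · exact ⟨_, htop f⟩
  · obtain ⟨f, rfl⟩ := hφ g
    exact ⟨of none * FreeSemigroup.map some (word f), by rw [map_mul, htop]; simp [gen]⟩

/-- The universal property of the presentation `cliffordRels`. -/
theorem exists_mulHom_of_cliffordRels {Q : Type*} [Semigroup Q] {rels : Set (FreeGroup ι)}
    (hφ : Function.Surjective φ) (hker : φ.ker = Subgroup.normalClosure rels)
    (q : Option (Option (ι × Bool)) → Q)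
    (hq : ∀ r ∈ cliffordRels rels, lift q r.1 = lift q r.2) :
    ∃ g : CliffordPair φ →ₙ* Q, ∀ a, g (gen φ a) = q a := by
  obtain ⟨hfree, hidem, hone, hcomm, hrels⟩ := forall_cliffordRels_iff.1 hq
  obtain ⟨h, hh⟩ := exists_mulHom_of_freeGroupRels _ hfree
  have hlift (u) : lift (fun a => q (some a)) u = h (lift freeGroupGen u) :=
    (DFunLike.congr_fun (FreeSemigroup.hom_ext (f := h.comp (lift freeGroupGen))
      (g := lift fun a => q (some a)) (funext fun a => hh a)) u).symm
  have hcomm' (f) : q none * h f = h f * q none := by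
    obtain ⟨u, rfl⟩ := lift_freeGroupGen_surjective ι f
    induction u using FreeSemigroup.recOnMul with
    | ih1 a => rw [lift_of, hh, hcomm]
    | ih2 a v ha hv => rw [map_mul, map_mul, ← mul_assoc, ha, mul_assoc, hv, mul_assoc]
  have hwd {f f' : FreeGroup ι} (hff' : φ f = φ f') : q none * h f = q none * h f' := by
    refine mul_eq_of_map_eq hker h (q none) ?_ hcomm' (fun r hr => ?_) hff'
    · rw [show (1 : FreeGroup ι) = freeGroupGen none from rfl, hh, hone]
    · have := hrels r hr
      rwa [hlift, lift_freeGroupGen_word] at this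
  let σ : G → FreeGroup ι := Function.surjInv hφ
  have hσ (g) : φ (σ g) = g := Function.surjInv_eq hφ g
  refine ⟨⟨fun
    | top f => h f
    | bot g => q none * h (σ g), ?_⟩, ?_⟩
  · rintro (f | g) (f' | g')
    · exact map_mul h f f'
    · change q none * h (σ (φ f * g')) = h f * (q none * h (σ g'))
      rw [← mul_assoc, ← hcomm', mul_assoc, ← map_mul]
      exact hwd (by simp [hσ])
    · change q none * h (σ (g * φ f')) = q none * h (σ g) * h f'
      rw [mul_assoc, ← map_mul]
      exact hwd (by simp [hσ])
    · change q none * h (σ (g * g')) = q none * h (σ g) * (q none * h (σ g'))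
      rw [← mul_assoc, mul_assoc (q none), ← hcomm', ← mul_assoc, hidem, mul_assoc, ← map_mul]
      exact hwd (by simp [hσ])
  · rintro (_ | a)
    · change q none * h (σ 1) = q none
      rw [hwd (f' := freeGroupGen none) (by rw [hσ]; exact (map_one φ).symm), hh, hone]
    · exact hh a

end CliffordPair

/-- The Clifford semigroup of a finite group presentation is finitely presented. -/
theorem isFinitelyPresentedSemigroup_cliffordPair {ι G : Type*} [Finite ι] [Group G]
    {φ : FreeGroup ι →* G} (hφ : Function.Surjective φ) {rels : Set (FreeGroup ι)}
    (hfin : rels.Finite) (hker : φ.ker = Subgroup.normalClosure rels) :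
    IsFinitelyPresentedSemigroup (CliffordPair φ) :=
  isFinitelyPresentedSemigroup_of_universal (CliffordPair.cliffordRels rels)
    ((((((finite_freeGroupRels ι).image _).union (Set.finite_singleton _)).union
      (Set.finite_singleton _)).union (Set.finite_range _)).union (hfin.image _))
    (CliffordPair.gen φ) (CliffordPair.lift_gen_surjective hφ) (CliffordPair.gen_rels hker)
    (CliffordPair.exists_mulHom_of_cliffordRels hφ hker)

/-! ### Free groups are hopfian -/

theorem IsHopfian.of_mulEquiv {S T : Type*} [Semigroup S] [Semigroup T] (e : S ≃* T)
    (h : IsHopfian S) : IsHopfian T := by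
  intro f hf
  have := (h ((e.symm : T →ₙ* S).comp (f.comp (e : S →ₙ* T)))
    (e.symm.surjective.comp (hf.comp e.surjective))).1
  refine ⟨fun x y hxy => ?_, hf⟩
  obtain ⟨x, rfl⟩ := e.surjective x
  obtain ⟨y, rfl⟩ := e.surjective y
  exact congrArg e (this (congrArg e.symm hxy))

theorem MonoidHom.finite_of_fg (G H : Type*) [Group G] [Group.FG G] [Group H] [Finite H] :
    Finite (G →* H) := by
  obtain ⟨s, hs⟩ := Group.fg_def.1 (inferInstance : Group.FG G)
  refine Finite.of_injective (fun (π : G →* H) (x : s) => π x) fun π π' h => ?_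
  exact MonoidHom.eq_of_eqOn_dense hs fun x hx => congrFun h ⟨x, hx⟩

/-- Malcev: finitely generated residually finite groups are hopfian. -/
theorem isHopfian_of_residuallyFinite (G : Type*) [Group G] [Group.FG G]
    [Group.ResiduallyFinite G] : IsHopfian G := by
  intro f hf
  let θ : G →* G := MonoidHom.mk' f (map_mul f)
  suffices Function.Injective θ from ⟨this, hf⟩
  refine (injective_iff_map_eq_one θ).2 fun w hw => ?_
  refine Group.eq_one_iff_forall_finiteIndexNormalSubroup w fun N => ?_
  have : Finite (G ⧸ N.toSubgroup) := inferInstance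
  have := MonoidHom.finite_of_fg G (G ⧸ N.toSubgroup)
  -- Precomposition with `θ` permutes the finite set of homomorphisms to the finite quotient, so
  -- the projection factors through `θ`.
  obtain ⟨π, hπ⟩ := (Finite.injective_iff_surjective.1
    fun (π π' : G →* G ⧸ N.toSubgroup) (h : π.comp θ = π'.comp θ) =>
      (MonoidHom.cancel_right hf).1 h) (QuotientGroup.mk' N.toSubgroup)
  have : QuotientGroup.mk' N.toSubgroup w = 1 := by
    rw [← hπ]
    simp [hw]
  exact (QuotientGroup.eq_one_iff w).1 this

/-- Any word in a free group acts on the finite set of its suffixes, through permutations assigned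
to the generators, in such a way that it moves `1` to the element it represents. -/
theorem FreeGroup.exists_perm_suffixes {ι : Type*} (L : List (ι × Bool)) :
    ∃ (X : Set (FreeGroup ι)) (_ : X.Finite) (σ : ι → Equiv.Perm X) (x : X),
      (x : FreeGroup ι) = 1 ∧ (FreeGroup.lift σ (FreeGroup.mk L) x : FreeGroup ι) = mk L := by
  let X : Set (FreeGroup ι) := mk '' {T | T ∈ L.tails}
  have hX : X.Finite := (List.finite_toSet L.tails).image _
  have : Finite X := hX
  have hσ (i : ι) : ∃ σ : Equiv.Perm X, ∀ x y : X, (y : FreeGroup ι) = of i * x → σ x = y := by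
    -- Multiplication by `of i` is injective where it does not leave `X`.
    obtain ⟨σ, hσ⟩ := Equiv.Perm.exists_extending_pair
      (α := {x : X // of i * (x : FreeGroup ι) ∈ X})
      (fun x => x.1) (fun x => ⟨of i * x.1, x.2⟩) Subtype.val_injective
      (fun x y h => Subtype.ext (Subtype.ext (mul_left_cancel (congrArg Subtype.val h))))
    refine ⟨σ, fun x y h => ?_⟩
    rw [hσ ⟨x, h ▸ y.2⟩]
    exact Subtype.ext h.symm
  choose σ hσ using hσ
  have hmem {T : List (ι × Bool)} (hT : T <:+ L) : mk T ∈ X := ⟨T, (List.mem_tails _ _).2 hT, rfl⟩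
  refine ⟨X, hX, σ, ⟨mk [], hmem List.nil_suffix⟩, rfl, ?_⟩
  suffices ∀ (T : List (ι × Bool)) (hT : T <:+ L),
      FreeGroup.lift σ (mk T) ⟨mk [], hmem List.nil_suffix⟩ = ⟨mk T, hmem hT⟩ by
    rw [this L List.suffix_rfl]
  intro T hT
  induction T with
  | nil => exact DFunLike.congr_fun (_root_.map_one (FreeGroup.lift σ)) _
  | cons p T ih =>
    have hT' : T <:+ L := (List.suffix_cons p T).trans hT
    obtain ⟨i, _ | _⟩ := p
    · have hmk : mk ((i, false) :: T) = (of i)⁻¹ * mk T := rfl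
      have hlift : FreeGroup.lift σ (mk ((i, false) :: T)) = (σ i)⁻¹ * FreeGroup.lift σ (mk T) := by
        rw [hmk, _root_.map_mul, _root_.map_inv, lift_apply_of]
      rw [hlift, Equiv.Perm.mul_apply, ih hT', Equiv.Perm.inv_eq_iff_eq]
      exact (hσ i _ _ (mul_inv_cancel_left (of i) (mk T)).symm).symm
    · have hmk : mk ((i, true) :: T) = of i * mk T := rfl
      have hlift : FreeGroup.lift σ (mk ((i, true) :: T)) = σ i * FreeGroup.lift σ (mk T) := by
        rw [hmk, _root_.map_mul, lift_apply_of]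
      rw [hlift, Equiv.Perm.mul_apply, ih hT']
      exact hσ i _ _ hmk

instance FreeGroup.residuallyFinite (ι : Type*) : Group.ResiduallyFinite (FreeGroup ι) := by
  refine Group.residuallyFinite_iff_exists_finiteIndexNormalSubgroup.2 fun g hg => ?_
  obtain ⟨L, rfl⟩ := Quot.exists_rep g
  obtain ⟨X, hX, σ, x, hx, h⟩ := FreeGroup.exists_perm_suffixes L
  have : Finite X := hX
  refine ⟨⟨(FreeGroup.lift σ).ker, inferInstance, inferInstance⟩, fun hker => hg ?_⟩
  have hker : FreeGroup.lift σ (FreeGroup.mk L) = 1 := hker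
  rw [hker, Equiv.Perm.one_apply, hx] at h
  exact h.symm

theorem isHopfian_freeGroup (ι : Type*) [Finite ι] : IsHopfian (FreeGroup ι) :=
  isHopfian_of_residuallyFinite _

/-! ### Neumann's group -/

theorem neumannMap_eq_mk : neumannMap = PresentedGroup.mk neumannRels :=
  FreeGroup.ext_hom _ _ fun _ => by simp [neumannMap, PresentedGroup.of]

theorem neumannMap_surjective : Function.Surjective neumannMap :=
  neumannMap_eq_mk ▸ PresentedGroup.mk_surjective _

theorem ker_neumannMap : neumannMap.ker = Subgroup.normalClosure neumannRels :=
  neumannMap_eq_mk ▸ QuotientGroup.ker_mk' _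

theorem neumannMap_eq_one {r : FreeGroup (Fin 3)} (hr : r ∈ neumannRels) : neumannMap r = 1 :=
  MonoidHom.mem_ker.1 (ker_neumannMap ▸ Subgroup.subset_normalClosure hr)

theorem lift_neumannRels_iff {H : Type*} [Group H] {f : Fin 3 → H} :
    (∀ r ∈ neumannRels, FreeGroup.lift f r = 1) ↔
      (f 0)⁻¹ * f 1 * f 0 = f 1 ^ 2 ∧ f 1 * f 2 = f 2 * f 1 := by
  simp [neumannRels, mul_inv_eq_one, -mul_inv_rev]

theorem neumannGroup_relations :
    ((PresentedGroup.of 0)⁻¹ * PresentedGroup.of 1 * PresentedGroup.of 0 : NeumannGroup) =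
        PresentedGroup.of 1 ^ 2 ∧
      (PresentedGroup.of 1 * PresentedGroup.of 2 : NeumannGroup) =
        PresentedGroup.of 2 * PresentedGroup.of 1 :=
  lift_neumannRels_iff.1 fun _ hr => neumannMap_eq_one hr

open FreeGroup in
/-- The automorphism `x ↦ x`, `y ↦ x⁻¹yx`, `z ↦ z` of the free group, as an endomorphism. -/
def conjEndo : FreeGroup (Fin 3) →* FreeGroup (Fin 3) :=
  lift ![of 0, (of 0)⁻¹ * of 1 * of 0, of 2]

theorem conjEndo_surjective : Function.Surjective conjEndo := by
  rw [← MonoidHom.range_eq_top, eq_top_iff, ← FreeGroup.closure_range_of, Subgroup.closure_le]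
  rintro _ ⟨i, rfl⟩
  fin_cases i
  · exact ⟨.of 0, by simp [conjEndo]⟩
  · exact ⟨.of 0 * .of 1 * (.of 0)⁻¹, by simp [conjEndo, mul_assoc]⟩
  · exact ⟨.of 2, by simp [conjEndo]⟩

/-- The endomorphism `a ↦ a`, `b ↦ a⁻¹ba = b²`, `c ↦ c` of Neumann's group. -/
def neumannEndo : NeumannGroup →* NeumannGroup :=
  PresentedGroup.toGroup (f := fun i => neumannMap (conjEndo (.of i))) <| by
    obtain ⟨h₁, h₂⟩ := neumannGroup_relations
    refine lift_neumannRels_iff.2 ⟨?_, ?_⟩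
    · simp only [conjEndo, neumannMap, FreeGroup.lift_apply_of, Matrix.cons_val, map_mul, map_inv]
      nth_rw 1 [h₁]
      rw [pow_two, pow_two]
      group
    · simp only [conjEndo, neumannMap, FreeGroup.lift_apply_of, Matrix.cons_val, map_mul, map_inv]
      rw [h₁]
      exact Commute.pow_left h₂ 2

theorem neumannEndo_neumannMap (f : FreeGroup (Fin 3)) :
    neumannEndo (neumannMap f) = neumannMap (conjEndo f) :=
  DFunLike.congr_fun (FreeGroup.ext_hom (neumannEndo.comp neumannMap) (neumannMap.comp conjEndo)
    fun i => by simp [neumannEndo, neumannMap]) f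

theorem neumannEndo_surjective : Function.Surjective neumannEndo := fun g => by
  obtain ⟨f, rfl⟩ := neumannMap_surjective g
  obtain ⟨f, rfl⟩ := conjEndo_surjective f
  exact ⟨neumannMap f, neumannEndo_neumannMap f⟩

/-- The permutation of `ℚ` that is `t ↦ t + 1` on the integers and the identity elsewhere. -/
def shiftIntegers : Equiv.Perm ℚ where
  toFun t := if Int.fract t = 0 then t + 1 else t
  invFun t := if Int.fract t = 0 then t - 1 else t
  left_inv t := by by_cases h : Int.fract t = 0 <;> simp [h]
  right_inv t := by by_cases h : Int.fract t = 0 <;> simp [h]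

open FreeGroup in
/-- The commutator of `aba⁻¹` and `c` is a nontrivial element of the kernel of `neumannEndo`. -/
theorem exists_neumannMap_ne_one :
    ∃ f : FreeGroup (Fin 3), neumannMap f ≠ 1 ∧ neumannMap (conjEndo f) = 1 := by
  have hmul (t : ℚ) : Equiv.mulRight₀ (1 / 2 : ℚ) (by norm_num) t = t * (1 / 2) := rfl
  have hc (t : ℚ) : shiftIntegers t = if Int.fract t = 0 then t + 1 else t := rfl
  -- The permutations `t ↦ t / 2` and `t ↦ t + 1`, for `a` and `b`; they compose as functions.
  let p : Fin 3 → Equiv.Perm ℚ :=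
    ![Equiv.mulRight₀ (1 / 2 : ℚ) (by norm_num), Equiv.addRight 1, shiftIntegers]
  have hp : ∀ r ∈ neumannRels, lift p r = 1 := by
    refine lift_neumannRels_iff.2 ⟨?_, ?_⟩
    · rw [mul_assoc, inv_mul_eq_iff_eq_mul]
      ext t
      simp only [p, Matrix.cons_val, Equiv.Perm.mul_apply, pow_two, hmul, Equiv.coe_addRight]
      ring
    · ext t
      by_cases h : Int.fract t = 0 <;> simp [p, hc, h]
  have hfactor (f) : PresentedGroup.toGroup hp (neumannMap f) = lift p f :=
    DFunLike.congr_fun (FreeGroup.ext_hom ((PresentedGroup.toGroup hp).comp neumannMap) (lift p)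
      fun i => by simp [neumannMap]) f
  refine ⟨of 0 * of 1 * (of 0)⁻¹ * of 2 * (of 2 * (of 0 * of 1 * (of 0)⁻¹))⁻¹, fun h => ?_, ?_⟩
  · have h := hfactor _ ▸ congrArg (PresentedGroup.toGroup hp) h
    rw [_root_.map_one, _root_.map_mul, _root_.map_inv, mul_inv_eq_one] at h
    -- The two products send `0` to `3 / 2` and to `1 / 2`.
    have hinv (t : ℚ) : (Equiv.mulRight₀ (1 / 2 : ℚ) (by norm_num))⁻¹ t = t * 2 := by
      rw [Equiv.Perm.inv_eq_iff_eq, hmul]; ring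
    have hfract : Int.fract (1 / 2 : ℚ) ≠ 0 := by norm_num [Int.fract]
    have := DFunLike.congr_fun h 0
    simp only [p, _root_.map_mul, _root_.map_inv, lift_apply_of, Matrix.cons_val,
      Equiv.Perm.mul_apply, hmul, hinv, hc, Equiv.coe_addRight, Int.fract_zero, zero_mul, zero_add,
      one_mul, hfract, if_true, if_false] at this
    norm_num at this
  · simp only [conjEndo, _root_.map_mul, _root_.map_inv, lift_apply_of, Matrix.cons_val]
    rw [mul_inv_eq_one]
    simp only [mul_assoc, mul_inv_cancel_left, mul_inv_cancel, mul_one]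
    exact neumannGroup_relations.2

theorem neumannEndo_not_injective : ¬ Function.Injective neumannEndo := fun h => by
  obtain ⟨f, hf, hf'⟩ := exists_neumannMap_ne_one
  exact hf (h (by rw [neumannEndo_neumannMap, hf', map_one]))

theorem not_isHopfian_neumannGroup : ¬ IsHopfian NeumannGroup := fun h =>
  neumannEndo_not_injective (h (neumannEndo : NeumannGroup →ₙ* NeumannGroup)
    neumannEndo_surjective).1

theorem not_isHopfian_neumannClifford : ¬ IsHopfian NeumannClifford := fun h =>
  neumannEndo_not_injective fun _ _ hgg' => CliffordPair.bot.inj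
    ((h _ (CliffordPair.map_surjective neumannEndo_neumannMap conjEndo_surjective
      neumannEndo_surjective)).1 (congrArg CliffordPair.bot hgg'))

theorem isFinitelyPresentedSemigroup_neumannClifford :
    IsFinitelyPresentedSemigroup NeumannClifford :=
  isFinitelyPresentedSemigroup_cliffordPair neumannMap_surjective
    (by simp [neumannRels]) ker_neumannMap

theorem mainTheorem3 :
    -- the group `G` is non-hopfian, and the map `F → G` is surjective
    ¬ IsHopfian NeumannGroup ∧ Function.Surjective neumannMap ∧
    -- `S` is finitely presented and non-hopfian
    IsFinitelyPresentedSemigroup NeumannClifford ∧ ¬ IsHopfian NeumannClifford ∧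
    -- the subsemigroup `F` of `S` is a copy of the free group of rank 3, is hopfian and finitely
    -- presented, and has Green index 2 in `S`
    Function.Injective (CliffordPair.topHom neumannMap) ∧
    IsHopfian (CliffordPair.upper neumannMap) ∧
    IsFinitelyPresentedSemigroup (CliffordPair.upper neumannMap) ∧
    greenIndex (CliffordPair.upper neumannMap) = 2 ∧
    -- hopficity is not inherited by finite Green index extensions
    ¬ (∀ (S : Type) [Semigroup S] (T : Subsemigroup S),
        IsFinitelyPresentedSemigroup S → IsFinitelyPresentedSemigroup T →
        greenIndex T < ⊤ → IsHopfian T → IsHopfian S) := by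
  have hhopf : IsHopfian (CliffordPair.upper neumannMap) :=
    (isHopfian_freeGroup (Fin 3)).of_mulEquiv (CliffordPair.upperEquiv neumannMap)
  have hfp : IsFinitelyPresentedSemigroup (CliffordPair.upper neumannMap) :=
    (isFinitelyPresentedSemigroup_freeGroup (Fin 3)).of_mulEquiv
      (CliffordPair.upperEquiv neumannMap)
  have hindex := CliffordPair.greenIndex_upper neumannMap_surjective
  exact ⟨not_isHopfian_neumannGroup, neumannMap_surjective,
    isFinitelyPresentedSemigroup_neumannClifford, not_isHopfian_neumannClifford,
    CliffordPair.topHom_injective, hhopf, hfp, hindex, fun h =>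
      not_isHopfian_neumannClifford (h _ _ isFinitelyPresentedSemigroup_neumannClifford hfp
        (hindex ▸ ENat.natCast_lt_top 2) hhopf)⟩
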